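/- Let $\Bbbk$ be a commutative ring, $H$ a $\Bbbk$-bialgebra (no antipode is assumed), and $A$ a left $H$-comodule-algebra, that is, a $\Bbbk$-algebra with a coassociative and counital morphism of $\Bbbk$-algebras $\nu:A\to H\otimes_{\Bbbk} A$, $\nu(a)=\sum a_1\otimes a_2$. Let $B$ be any $\Bbbk$-subalgebra of the algebra of coinvariants $A^{\mathrm{co}H}=\{a\in A\mid \nu(a)=1\otimes a\}$. Let $\mathsf{Hopf}(H;A,H)$ be the category whose objects are the left $A$-modules $M$ with a left $H$-comodule structure $\zeta:M\to H\otimes_{\Bbbk} M$ such that $\zeta(am)=\nu(a)\zeta(m)$ for all $a\in A$, $m\in M$, where $(h\otimes a)(h'\otimes m)=hh'\otimes am$, and whose morphisms are the $A$-linear and $H$-colinear maps. Let $\mathcal{A}:B\text{-}\mathsf{Mod}\to\mathsf{Hopf}(H;A,H)$ be the functor sending a left $B$-module $M$ to $A\otimes_B M$, with $A$ acting on the left factor and with coaction $a\otimes_B m\mapsto\sum a_1\otimes(a_2\otimes_B m)$. Consider the following statements. (i) $A$ is faithfully flat as a right $B$-module, and the canonical map $A\otimes_B A\to H\otimes_{\Bbbk}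 A$, $a\otimes_B a'\mapsto\sum a_1\otimes a_2a'$, is bijective. (ii) The functor $\mathcal{A}:B\text{-}\mathsf{Mod}\to\mathsf{Hopf}(H;A,H)$ is an equivalence of categories. (iii) The functor $\mathcal{S}=A\otimes_B(-)$ from the category of left $B$-modules to itself is faithful. Then (i) $\Rightarrow$ (ii) $\Rightarrow$ (iii). If in addition $H$ is flat as a $\Bbbk$-module, then (i) and (ii) are equivalent. -/

import Mathlib

open CategoryTheory TensorProduct

universe u

noncomputable section

namespace HopfGalois

/-! ### The relative tensor product `A ⊗_B M` over a (noncommutative) subalgebra `B` of `A` -/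

section RelTensor

variable {k A : Type u} [CommRing k] [Ring A] [Algebra k A] (B : Subalgebra k A)
variable (M : Type u) [AddCommGroup M] [Module k M] [Module B M]

/-- The left `A`-submodule of `A ⊗_k M` generated by the elements `ab ⊗ m - a ⊗ bm`. -/
def relations : Submodule A (A ⊗[k] M) :=
  Submodule.span A
    {t | ∃ (a : A) (b : B) (m : M), t = (a * (b : A)) ⊗ₜ[k] m - a ⊗ₜ[k] (b • m)}

/-- `A ⊗_B M`, the quotient of `A ⊗_k M` by the relations `ab ⊗ m = a ⊗ bm`. It is a left
`A`-module (hence a left `B`-module and a `k`-module) through the left factor. -/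
abbrev RelTensor : Type u := (A ⊗[k] M) ⧸ relations B M

variable {M}

/-- The pure tensor `a ⊗_B m`, as a `k`-linear function of `a`. -/
def RelTensor.mk (m : M) : A →ₗ[k] RelTensor B M :=
  (relations B M).mkQ.restrictScalars k ∘ₗ (TensorProduct.mk k A M).flip m

variable {B}

theorem RelTensor.smul_mk (a a' : A) (m : M) :
    a • RelTensor.mk B m a' = RelTensor.mk B m (a * a') := rfl

theorem RelTensor.mk_add (m m' : M) (a : A) :
    RelTensor.mk B (m + m') a = RelTensor.mk B m a + RelTensor.mk B m' a := by
  simp [RelTensor.mk]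

theorem RelTensor.mk_mul (a : A) (b : B) (m : M) :
    RelTensor.mk B m (a * (b : A)) = RelTensor.mk B (b • m) a :=
  (Submodule.Quotient.eq _).2 (Submodule.subset_span ⟨a, b, m, rfl⟩)

theorem RelTensor.induction_on {p : RelTensor B M → Prop} (x : RelTensor B M)
    (zero : p 0) (mk : ∀ m a, p (RelTensor.mk B m a)) (add : ∀ x y, p x → p y → p (x + y)) :
    p x := by
  obtain ⟨t, rfl⟩ := (relations B M).mkQ_surjective x
  induction t with
  | zero => simpa using zero
  | tmul a m => exact mk m a
  | add x y hx hy => rw [map_add]; exact add _ _ hx hy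

theorem relations_le_ker {P : Type u} [AddCommGroup P] [Module k P] (f : A ⊗[k] M →ₗ[k] P)
    (hf : ∀ (a : A) (b : B) (m : M), f ((a * (b : A)) ⊗ₜ[k] m) = f (a ⊗ₜ[k] (b • m))) :
    (relations B M).restrictScalars k ≤ LinearMap.ker f := by
  intro x hx
  have key : ∀ c : A, f (c • x) = 0 := by
    have hx' : x ∈ relations B M := hx
    clear hx
    unfold relations at hx'
    induction hx' using Submodule.span_induction with
    | mem x h =>
      obtain ⟨a, b, m, rfl⟩ := h
      intro c
      have := hf (c * a) b m
      simp only [smul_sub, TensorProduct.smul_tmul', smul_eq_mul, map_sub]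
      rw [← mul_assoc, this, sub_self]
    | zero => simp
    | add x y hx hy h1 h2 =>
      intro c
      rw [smul_add, map_add, h1, h2, add_zero]
    | smul r x hx h =>
      intro c
      rw [smul_smul]
      exact h (c * r)
  simpa using key 1

/-- A `k`-linear map out of `A ⊗_k M` that is balanced over `B` descends to `A ⊗_B M`. -/
def RelTensor.lift {P : Type u} [AddCommGroup P] [Module k P] (f : A ⊗[k] M →ₗ[k] P)
    (hf : ∀ (a : A) (b : B) (m : M), f ((a * (b : A)) ⊗ₜ[k] m) = f (a ⊗ₜ[k] (b • m))) :
    RelTensor B M →ₗ[k] P :=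
  ((relations B M).restrictScalars k).liftQ f (relations_le_ker f hf)

theorem RelTensor.lift_mk {P : Type u} [AddCommGroup P] [Module k P] (f : A ⊗[k] M →ₗ[k] P)
    (hf : ∀ (a : A) (b : B) (m : M), f ((a * (b : A)) ⊗ₜ[k] m) = f (a ⊗ₜ[k] (b • m)))
    (m : M) (a : A) : RelTensor.lift f hf (RelTensor.mk B m a) = f (a ⊗ₜ[k] m) := rfl

variable {N : Type u} [AddCommGroup N] [Module k N] [Module B N]
variable [IsScalarTower k B M] [IsScalarTower k B N]

/-- `A ⊗_B f : A ⊗_B M → A ⊗_B N`, `a ⊗ m ↦ a ⊗ f m`, for a `B`-linear map `f`. -/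
def RelTensor.map (f : M →ₗ[B] N) : RelTensor B M →ₗ[A] RelTensor B N :=
  (relations B M).mapQ (relations B N)
    (TensorProduct.AlgebraTensorModule.map LinearMap.id (f.restrictScalars k)) (by
      refine Submodule.span_le.2 ?_
      rintro _ ⟨a, b, m, rfl⟩
      refine Submodule.subset_span ⟨a, b, f m, ?_⟩
      simp)

theorem RelTensor.map_mk (f : M →ₗ[B] N) (m : M) (a : A) :
    RelTensor.map f (RelTensor.mk B m a) = RelTensor.mk B (f m) a := rfl

theorem RelTensor.map_comp_mk (f : M →ₗ[B] N) (m : M) :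
    (RelTensor.map f).restrictScalars k ∘ₗ RelTensor.mk B m = RelTensor.mk B (f m) := rfl

theorem RelTensor.map_id : RelTensor.map (LinearMap.id : M →ₗ[B] M) = LinearMap.id := by
  refine LinearMap.ext fun x => ?_
  induction x using RelTensor.induction_on with
  | zero => simp
  | add x y hx hy => rw [_root_.map_add, _root_.map_add, hx, hy]
  | mk m a => rfl

theorem RelTensor.map_comp {P : Type u} [AddCommGroup P] [Module k P] [Module B P]
    [IsScalarTower k B P] (g : N →ₗ[B] P) (f : M →ₗ[B] N) :
    RelTensor.map (g ∘ₗ f) = RelTensor.map g ∘ₗ RelTensor.map f := by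
  refine LinearMap.ext fun x => ?_
  induction x using RelTensor.induction_on with
  | zero => simp
  | add x y hx hy => rw [_root_.map_add, _root_.map_add, hx, hy]
  | mk m a => rfl

variable (B) in
/-- `A` is faithfully flat as a right `B`-module: a sequence of left `B`-modules is exact if and
only if its image under `A ⊗_B (-)` is exact. -/
def FaithfullyFlatRight : Prop :=
  ∀ (M₁ M₂ M₃ : Type u) [AddCommGroup M₁] [AddCommGroup M₂] [AddCommGroup M₃]
    [Module k M₁] [Module k M₂] [Module k M₃] [Module B M₁] [Module B M₂] [Module B M₃]
    [IsScalarTower k B M₁] [IsScalarTower k B M₂] [IsScalarTower k B M₃]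
    (f : M₁ →ₗ[B] M₂) (g : M₂ →ₗ[B] M₃),
    Function.Exact f g ↔ Function.Exact (RelTensor.map f) (RelTensor.map g)

end RelTensor

/-! ### Comodules, comodule-algebras and Hopf modules -/

section Hopf

variable {k H A : Type u} [CommRing k] [Ring H] [Bialgebra k H] [Ring A] [Algebra k A]

/-- `ζ : M → H ⊗ M` is a left `H`-comodule structure: it is coassociative and counital. -/
structure IsLeftComodule {M : Type u} [AddCommGroup M] [Module k M]
    (ζ : M →ₗ[k] H ⊗[k] M) : Prop where
  coassoc : (TensorProduct.assoc k H H M).toLinearMap ∘ₗ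
    (Coalgebra.comul (R := k) (A := H)).rTensor M ∘ₗ ζ = ζ.lTensor H ∘ₗ ζ
  counit : (TensorProduct.lid k M).toLinearMap ∘ₗ
    (Coalgebra.counit (R := k) (A := H)).rTensor M ∘ₗ ζ = LinearMap.id

/-- The subalgebra of coinvariants `{a | ν a = 1 ⊗ a}`. -/
def coinvariants (ν : A →ₐ[k] H ⊗[k] A) : Subalgebra k A :=
  AlgHom.equalizer ν Algebra.TensorProduct.includeRight

/-- The componentwise product `(H ⊗ A) × (H ⊗ M) → H ⊗ M`,
`(h ⊗ a) (h' ⊗ m) = h h' ⊗ a m`, for a left `A`-module `M`. -/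
def act (M : Type u) [AddCommGroup M] [Module k M] [Module A M] [IsScalarTower k A M] :
    H ⊗[k] A →ₗ[k] H ⊗[k] M →ₗ[k] H ⊗[k] M :=
  TensorProduct.map₂ (LinearMap.mul k H) (Algebra.lsmul k k M).toLinearMap

@[simp] theorem act_tmul (M : Type u) [AddCommGroup M] [Module k M] [Module A M]
    [IsScalarTower k A M] (h h' : H) (a : A) (m : M) :
    act M (h ⊗ₜ[k] a) (h' ⊗ₜ[k] m) = (h * h') ⊗ₜ[k] (a • m) := rfl

/-- A left Hopf module over the `H`-comodule-algebra `(A, ν)`: a left `A`-module and left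
`H`-comodule `M` such that `ζ (a m) = ν(a) ζ(m)`. -/
structure HopfMod (ν : A →ₐ[k] H ⊗[k] A) where
  carrier : Type u
  [addCommGroup : AddCommGroup carrier]
  [moduleBase : Module k carrier]
  [module : Module A carrier]
  [isScalarTower : IsScalarTower k A carrier]
  coaction : carrier →ₗ[k] H ⊗[k] carrier
  isLeftComodule : IsLeftComodule coaction
  coaction_smul : ∀ (a : A) (m : carrier), coaction (a • m) = act carrier (ν a) (coaction m)

attribute [instance] HopfMod.addCommGroup HopfMod.moduleBase HopfMod.module
  HopfMod.isScalarTower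

variable {ν : A →ₐ[k] H ⊗[k] A}

/-- A morphism of Hopf modules is a map that is both `A`-linear and `H`-colinear. -/
@[ext] structure HopfMod.Hom (M N : HopfMod ν) where
  toLinearMap : M.carrier →ₗ[A] N.carrier
  colinear : N.coaction ∘ₗ toLinearMap.restrictScalars k =
    (toLinearMap.restrictScalars k).lTensor H ∘ₗ M.coaction

/-- The category `Hopf(H; A, H)`. -/
instance : Category (HopfMod ν) where
  Hom := HopfMod.Hom
  id M := ⟨LinearMap.id, by
    have : (LinearMap.id : M.carrier →ₗ[A] M.carrier).restrictScalars k = LinearMap.id := rfl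
    rw [this, LinearMap.lTensor_id]; rfl⟩
  comp {M N P} f g := ⟨g.toLinearMap ∘ₗ f.toLinearMap, by
    have : (g.toLinearMap ∘ₗ f.toLinearMap).restrictScalars k =
      g.toLinearMap.restrictScalars k ∘ₗ f.toLinearMap.restrictScalars k := rfl
    rw [this, LinearMap.lTensor_comp, ← LinearMap.comp_assoc, g.colinear, LinearMap.comp_assoc,
      f.colinear, LinearMap.comp_assoc]⟩

/-! ### The coaction on `A ⊗_B M` and the canonical map -/

section Coaction

variable {B : Subalgebra k A} {M : Type u} [AddCommGroup M] [Module k M] [Module B M]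

/-- If `B` consists of coinvariants, then `ν(a b) = ν(a) (1 ⊗ b)` for `b` in `B`, so that any
`k`-bilinear `B`-balanced map stays balanced after `ν` is applied to its first argument. -/
theorem lTensor_balanced {P : Type u} [AddCommGroup P] [Module k P]
    (hB : B ≤ coinvariants ν) (a : A) (b : B) (f g : A →ₗ[k] P)
    (hfg : ∀ a', f (a' * (b : A)) = g a') :
    f.lTensor H (ν (a * (b : A))) = g.lTensor H (ν a) := by
  have hb : ν (b : A) = 1 ⊗ₜ[k] (b : A) := hB b.2
  rw [map_mul, hb]
  induction ν a with
  | zero => simp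
  | tmul h a' => simp [hfg]
  | add x y hx hy => rw [add_mul, map_add, map_add, hx, hy]

theorem coaction_aux (m : M) (a : A) :
    (((relations B M).mkQ.restrictScalars k).lTensor H ∘ₗ
      (TensorProduct.assoc k H A M).toLinearMap ∘ₗ ν.toLinearMap.rTensor M) (a ⊗ₜ[k] m) =
    (RelTensor.mk B m).lTensor H (ν a) := by
  simp only [LinearMap.comp_apply, LinearMap.rTensor_tmul, AlgHom.toLinearMap_apply]
  induction ν a with
  | zero => simp
  | tmul h a' => rfl
  | add x y hx hy => rw [add_tmul, map_add, map_add, map_add, hx, hy]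

variable (M) in
/-- The map `A ⊗_B M → H ⊗ (A ⊗_B M)`, `a ⊗ m ↦ ∑ a₁ ⊗ (a₂ ⊗ m)`, for `ν a = ∑ a₁ ⊗ a₂`. -/
def relCoaction (hB : B ≤ coinvariants ν) : RelTensor B M →ₗ[k] H ⊗[k] RelTensor B M :=
  RelTensor.lift (((relations B M).mkQ.restrictScalars k).lTensor H ∘ₗ
      (TensorProduct.assoc k H A M).toLinearMap ∘ₗ ν.toLinearMap.rTensor M) (by
    intro a b m
    rw [coaction_aux, coaction_aux]
    exact lTensor_balanced hB a b _ _ fun a' => RelTensor.mk_mul a' b m)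

theorem relCoaction_mk (hB : B ≤ coinvariants ν) (m : M) (a : A) :
    relCoaction M hB (RelTensor.mk B m a) = (RelTensor.mk B m).lTensor H (ν a) :=
  coaction_aux m a

theorem relCoaction_comp_mk (hB : B ≤ coinvariants ν) (m : M) :
    relCoaction M hB ∘ₗ RelTensor.mk B m = (RelTensor.mk B m).lTensor H ∘ₗ ν.toLinearMap :=
  LinearMap.ext fun a => relCoaction_mk hB m a

theorem relCoaction_isLeftComodule (hν : IsLeftComodule ν.toLinearMap)
    (hB : B ≤ coinvariants ν) : IsLeftComodule (relCoaction M hB) := by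
  constructor
  · refine LinearMap.ext fun x => ?_
    induction x using RelTensor.induction_on with
    | zero => simp
    | add x y hx hy => rw [map_add, map_add, hx, hy]
    | mk m a =>
      have h := LinearMap.congr_fun hν.coassoc a
      simp only [LinearMap.comp_apply, AlgHom.toLinearMap_apply, LinearEquiv.coe_coe] at h ⊢
      rw [relCoaction_mk, ← LinearMap.lTensor_comp_apply, relCoaction_comp_mk,
        LinearMap.lTensor_comp_apply, ← h]
      induction ν a with
      | zero => simp
      | add x y hx hy => simp only [map_add, hx, hy]
      | tmul g a' =>
        simp only [LinearMap.lTensor_tmul, LinearMap.rTensor_tmul]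
        induction Coalgebra.comul (R := k) g with
        | zero => simp
        | add x y hx hy => simp only [map_add, add_tmul, hx, hy]
        | tmul g₁ g₂ => simp
  · refine LinearMap.ext fun x => ?_
    induction x using RelTensor.induction_on with
    | zero => simp
    | add x y hx hy => rw [map_add, map_add, hx, hy]
    | mk m a =>
      have h := LinearMap.congr_fun hν.counit a
      simp only [LinearMap.comp_apply, AlgHom.toLinearMap_apply, LinearEquiv.coe_coe,
        LinearMap.id_apply] at h ⊢
      rw [relCoaction_mk]
      conv_rhs => rw [← h]
      induction ν a with
      | zero => simp
      | add x y hx hy => simp only [map_add, hx, hy]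
      | tmul g a' => simp

theorem relCoaction_smul (hB : B ≤ coinvariants ν) (a : A) (x : RelTensor B M) :
    relCoaction M hB (a • x) = act (RelTensor B M) (ν a) (relCoaction M hB x) := by
  induction x using RelTensor.induction_on with
  | zero => simp
  | add x y hx hy => rw [smul_add, map_add, map_add, map_add, hx, hy]
  | mk m a' =>
    rw [RelTensor.smul_mk, relCoaction_mk, relCoaction_mk, map_mul]
    induction ν a with
    | zero => simp
    | add x y hx hy => rw [add_mul, map_add, map_add, LinearMap.add_apply, hx, hy]
    | tmul g c =>
      induction ν a' with
      | zero => simp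
      | add x y hx hy => rw [mul_add, map_add, map_add, map_add, hx, hy]
      | tmul g' c' => simp [RelTensor.smul_mk]

theorem relMap_colinear {N : Type u} [AddCommGroup N] [Module k N] [Module B N]
    [IsScalarTower k B M] [IsScalarTower k B N] (hB : B ≤ coinvariants ν) (f : M →ₗ[B] N) :
    relCoaction N hB ∘ₗ (RelTensor.map f).restrictScalars k =
      ((RelTensor.map f).restrictScalars k).lTensor H ∘ₗ relCoaction M hB := by
  refine LinearMap.ext fun x => ?_
  induction x using RelTensor.induction_on with
  | zero => simp
  | add x y hx hy => rw [map_add, map_add, hx, hy]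
  | mk m a =>
    simp only [LinearMap.comp_apply, LinearMap.restrictScalars_apply]
    rw [RelTensor.map_mk, relCoaction_mk, relCoaction_mk, ← LinearMap.lTensor_comp_apply,
      RelTensor.map_comp_mk]

variable (B) in
/-- The canonical map `A ⊗_B A → H ⊗ A`, `a ⊗ a' ↦ ∑ a₁ ⊗ a₂ a'`. -/
def canonicalMap (hB : B ≤ coinvariants ν) : RelTensor B A →ₗ[k] H ⊗[k] A :=
  RelTensor.lift (TensorProduct.lift
    (LinearMap.mk₂ k (fun a a' => ν a * (1 ⊗ₜ[k] a'))
      (by intros; simp [add_mul]) (by intros; simp)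
      (by intros; simp [tmul_add, mul_add]) (by intros; simp))) (by
    intro a b a'
    have hb : ν (b : A) = 1 ⊗ₜ[k] (b : A) := hB b.2
    simp [hb, mul_assoc, Subalgebra.smul_def])

end Coaction

/-! ### The functors `𝒜` and `𝒮` -/

section Functors

variable {B : Subalgebra k A}

/-- A left `B`-module is a `k`-module through `k → B`. -/
instance (M : ModuleCat.{u} B) : Module k M := Module.restrictScalars k B M

instance (M : ModuleCat.{u} B) : IsScalarTower k B M := IsScalarTower.restrictScalars k B M

/-- The functor `𝒜 : B-Mod ⥤ Hopf(H; A, H)`, `M ↦ A ⊗_B M`. -/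
def functorA (hν : IsLeftComodule ν.toLinearMap) (hB : B ≤ coinvariants ν) :
    ModuleCat.{u} B ⥤ HopfMod ν where
  obj M :=
    { carrier := RelTensor B M
      coaction := relCoaction M hB
      isLeftComodule := relCoaction_isLeftComodule hν hB
      coaction_smul := relCoaction_smul hB }
  map f := ⟨RelTensor.map f.hom, relMap_colinear hB f.hom⟩
  map_id _ := HopfMod.Hom.ext RelTensor.map_id
  map_comp f g := HopfMod.Hom.ext (RelTensor.map_comp g.hom f.hom)

variable (B) in
/-- The functor `𝒮 = A ⊗_B (-) : B-Mod ⥤ B-Mod`, with `b (a ⊗ m) = b a ⊗ m`. -/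
def functorS : ModuleCat.{u} B ⥤ ModuleCat.{u} B where
  obj M := ModuleCat.of B (RelTensor B M)
  map f := ModuleCat.ofHom ((RelTensor.map f.hom).restrictScalars B)
  map_id _ := ModuleCat.hom_ext (LinearMap.ext fun x => LinearMap.congr_fun RelTensor.map_id x)
  map_comp f g := ModuleCat.hom_ext
    (LinearMap.ext fun x => LinearMap.congr_fun (RelTensor.map_comp g.hom f.hom) x)

end Functors

end Hopf

end HopfGalois

end

open HopfGalois

/-! Two facts carry the argument. First, an `A`-module `P` has a Galois map from `A ⊗_B P` to `H ⊗
P`, equal to the canonical map when `P = A`. It is natural in `P`, so bijectivity for `A` gives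
bijectivity for every `P` (`galoisMap_bijective`). Second, `H ⊗ P` with `A` acting through `ν` is
the cofree Hopf module on `P`, so Hopf maps from `A ⊗_B N` to `H ⊗ P` are the `B`-linear maps `N →
P`.

(i) ⇒ (ii) is faithfully flat descent. The Galois maps turn a coaction into a descent datum and
coinvariants into descended elements. Faithful flatness makes `N → A ⊗_B N ⇉ A ⊗_B A ⊗_B N` an
equalizer (`exact_unit_descentDiff`), so the coinvariants of `A ⊗_B N` are `N`, whence full
faithfulness. Tensoring the sequence that defines the coinvariants of a Hopf module `M` shows that
they generate `M` freely over `B` (`extend_coinv_bijective`), whence essential surjectivity.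

(ii) ⇒ (iii) holds because `𝒜` and `𝒮` act by the same underlying maps.

(ii) ⇒ (i): if `𝒜` is an equivalence, `𝒜(A)` and the cofree Hopf module `H ⊗ A` represent the same
functor, and the comparison is the canonical map; flatness of `H` is not needed here. When `H` is
flat, kernels of Hopf maps are Hopf modules, so `𝒜` preserves injections; with right exactness and
faithfulness this is faithful flatness. -/

noncomputable section

namespace HopfGalois

/-! ### Extension of scalars along `B → A` -/

section Extension

variable {k A : Type u} [CommRing k] [Ring A] [Algebra k A] {B : Subalgebra k A}
variable {N : Type u} [AddCommGroup N] [Module k N] [Module B N]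

/-- `A`-linear maps out of `A ⊗_B N` are determined by their values on the `1 ⊗ n`. -/
theorem RelTensor.hom_ext {P : Type u} [AddCommGroup P] [Module A P] {f g : RelTensor B N →ₗ[A] P}
    (h : ∀ n, f (RelTensor.mk B n 1) = g (RelTensor.mk B n 1)) : f = g := by
  refine LinearMap.ext fun x => ?_
  induction x using RelTensor.induction_on with
  | zero => simp
  | add x y hx hy => rw [_root_.map_add, _root_.map_add, hx, hy]
  | mk n a =>
    have : RelTensor.mk B n a = a • RelTensor.mk B n 1 := by rw [RelTensor.smul_mk, mul_one]
    rw [this, map_smul, map_smul, h]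

variable (B N) in
/-- The unit `N → A ⊗_B N`, `n ↦ 1 ⊗ n`. -/
def RelTensor.unit : N →ₗ[B] RelTensor B N where
  toFun n := RelTensor.mk B n 1
  map_add' m n := RelTensor.mk_add m n 1
  map_smul' b n := by
    rw [← RelTensor.mk_mul, one_mul]
    change _ = (b : A) • RelTensor.mk B n 1
    rw [RelTensor.smul_mk, mul_one]

theorem RelTensor.unit_apply (n : N) : RelTensor.unit B N n = RelTensor.mk B n 1 := rfl

variable [IsScalarTower k B N]
variable {N' : Type u} [AddCommGroup N'] [Module k N'] [Module B N'] [IsScalarTower k B N']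
variable {N'' : Type u} [AddCommGroup N''] [Module k N''] [Module B N''] [IsScalarTower k B N'']
variable {P : Type u} [AddCommGroup P] [Module k P] [Module A P] [IsScalarTower k A P]

/-- The `A`-linear map `A ⊗_B N → P`, `a ⊗ n ↦ a j(n)`, induced by a `B`-linear map
`j : N → P`. -/
def RelTensor.extend (j : N →ₗ[B] P) : RelTensor B N →ₗ[A] P where
  toFun := RelTensor.lift (TensorProduct.lift
    ((Algebra.lsmul k k P).toLinearMap.compl₂ (j.restrictScalars k))) (by
      intro a b n
      simp [Subalgebra.smul_def])
  map_add' x y := _root_.map_add _ x y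
  map_smul' a x := by
    induction x using RelTensor.induction_on with
    | zero => simp
    | add x y hx hy => simp only [smul_add, _root_.map_add, hx, hy]
    | mk n a' =>
      rw [RelTensor.smul_mk, RelTensor.lift_mk, RelTensor.lift_mk]
      simp

theorem RelTensor.extend_mk (j : N →ₗ[B] P) (n : N) (a : A) :
    RelTensor.extend j (RelTensor.mk B n a) = a • j n := rfl

theorem RelTensor.map_zero : RelTensor.map (0 : N →ₗ[B] N') = 0 :=
  RelTensor.hom_ext fun n => by
    rw [RelTensor.map_mk, ← RelTensor.unit_apply]
    simp

theorem RelTensor.map_sub (f g : N →ₗ[B] N') :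
    RelTensor.map (f - g) = RelTensor.map f - RelTensor.map g :=
  RelTensor.hom_ext fun n => by
    rw [LinearMap.sub_apply, RelTensor.map_mk, RelTensor.map_mk, RelTensor.map_mk,
      ← RelTensor.unit_apply, ← RelTensor.unit_apply, ← RelTensor.unit_apply,
      LinearMap.sub_apply, _root_.map_sub]

/-- Injectivity is exactness of the pair `(0, f)`, and `0` is preserved by the tensor product. -/
theorem FaithfullyFlatRight.injective_iff (hB : FaithfullyFlatRight B) (f : N →ₗ[B] N') :
    Function.Injective f ↔ Function.Injective (RelTensor.map f) := by
  have h := hB N N N' 0 f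
  rw [RelTensor.map_zero] at h
  rw [injective_iff_map_eq_zero, injective_iff_map_eq_zero]
  simpa [Function.Exact, LinearMap.mem_range, Set.mem_range, eq_comm, forall_and,
    iff_def, or_imp] using h

/-- A map vanishes exactly when it is followed exactly by the identity; this is applied to `f - g`.
-/
theorem FaithfullyFlatRight.map_injective (hB : FaithfullyFlatRight B) {f g : N →ₗ[B] N'}
    (h : RelTensor.map f = RelTensor.map g) : f = g := by
  have h0 : RelTensor.map (f - g) = 0 := by rw [RelTensor.map_sub, h, sub_self]
  have := (hB N N' N' (f - g) LinearMap.id).2 (by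
    rw [h0, RelTensor.map_id]
    intro x
    simp [eq_comm])
  rw [← sub_eq_zero]
  exact LinearMap.ext fun x => (this ((f - g) x)).2 ⟨x, rfl⟩

/-- The map `1 ⊗ x - x ⊗ 1` whose kernel is described by faithfully flat descent. -/
def RelTensor.descentDiff (B : Subalgebra k A) (N : Type u) [AddCommGroup N] [Module k N]
    [Module B N] [IsScalarTower k B N] :
    RelTensor B N →ₗ[B] RelTensor B (RelTensor B N) :=
  (RelTensor.map (RelTensor.unit B N)).restrictScalars B - RelTensor.unit B (RelTensor B N)

theorem RelTensor.descentDiff_unit (n : N) :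
    RelTensor.descentDiff B N (RelTensor.unit B N n) = 0 :=
  sub_self (RelTensor.mk B (RelTensor.mk B n 1) 1)

/-- Extending the identity gives the multiplication `a ⊗ x ↦ a x`, which retracts the unit once `A
⊗_B (-)` has been applied. This is the splitting behind descent. -/
theorem RelTensor.extend_id_map_unit (y : RelTensor B N) :
    RelTensor.extend (B := B) LinearMap.id (RelTensor.map (RelTensor.unit B N) y) = y := by
  have : RelTensor.extend (B := B) (LinearMap.id : RelTensor B N →ₗ[B] RelTensor B N) ∘ₗ
      RelTensor.map (RelTensor.unit B N) = LinearMap.id :=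
    RelTensor.hom_ext fun n => one_smul A (RelTensor.mk B n 1)
  exact LinearMap.congr_fun this y

theorem FaithfullyFlatRight.unit_injective (hB : FaithfullyFlatRight B) :
    Function.Injective (RelTensor.unit B N) :=
  (hB.injective_iff _).2 (Function.LeftInverse.injective RelTensor.extend_id_map_unit)

/-- By faithful flatness it suffices to check exactness after `A ⊗_B (-)`, where multiplication is a
contracting homotopy. -/
theorem FaithfullyFlatRight.exact_unit_descentDiff (hB : FaithfullyFlatRight B) :
    Function.Exact (RelTensor.unit B N) (RelTensor.descentDiff B N) := by
  refine (hB _ _ _ _ _).2 fun y => ⟨fun hy => ?_, ?_⟩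
  · refine ⟨RelTensor.extend (B := B) LinearMap.id y, ?_⟩
    rw [RelTensor.descentDiff, RelTensor.map_sub, LinearMap.sub_apply, sub_eq_zero] at hy
    -- Multiplying the outer two factors in the kernel relation turns one side into `y` and, by
    -- naturality, the other into the image of the multiplied element.
    have h := congrArg (RelTensor.extend (B := B)
      (LinearMap.id : RelTensor B (RelTensor B N) →ₗ[B] _)) hy
    rw [RelTensor.extend_id_map_unit] at h
    refine Eq.trans ?_ h
    have : RelTensor.map (RelTensor.unit B N) ∘ₗ
        RelTensor.extend (B := B) (LinearMap.id : RelTensor B N →ₗ[B] RelTensor B N) =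
        RelTensor.extend (B := B) (LinearMap.id : RelTensor B (RelTensor B N) →ₗ[B] _) ∘ₗ
        RelTensor.map ((RelTensor.map (RelTensor.unit B N)).restrictScalars B) := by
      refine RelTensor.hom_ext fun x => ?_
      simp only [LinearMap.comp_apply, RelTensor.extend_mk, RelTensor.map_mk, one_smul,
        LinearMap.id_apply, LinearMap.restrictScalars_apply]
    exact LinearMap.congr_fun this y
  · rintro ⟨x, rfl⟩
    have : RelTensor.descentDiff B N ∘ₗ RelTensor.unit B N = 0 :=
      LinearMap.ext RelTensor.descentDiff_unit
    rw [← LinearMap.comp_apply, ← RelTensor.map_comp, this, RelTensor.map_zero,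
      LinearMap.zero_apply]

/-- `A ⊗_B (-)` is right exact. -/
theorem RelTensor.map_exact_of_surjective {f : N →ₗ[B] N'} {g : N' →ₗ[B] N''}
    (hfg : Function.Exact f g) (hg : Function.Surjective g) :
    Function.Exact (RelTensor.map f) (RelTensor.map g) := by
  intro x
  refine ⟨fun hx => ?_, ?_⟩
  · obtain ⟨t, rfl⟩ := (relations B N').mkQ_surjective x
    have hx' : TensorProduct.AlgebraTensorModule.map (LinearMap.id : A →ₗ[A] A)
        (g.restrictScalars k) t ∈ relations B N'' := (Submodule.Quotient.mk_eq_zero _).1 hx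
    -- Since `g` is surjective, relations over `N''` lift to relations over `N'`. Correcting `t` by
    -- such a lift `r` puts it in the kernel of `A ⊗_k g`, where right exactness over `k` applies.
    have hle : relations B N'' ≤ (relations B N').map
        (TensorProduct.AlgebraTensorModule.map LinearMap.id (g.restrictScalars k)) := by
      refine Submodule.span_le.2 ?_
      rintro _ ⟨a, b, m, rfl⟩
      obtain ⟨m, rfl⟩ := hg m
      exact ⟨_, Submodule.subset_span ⟨a, b, m, rfl⟩, by simp⟩
    obtain ⟨r, hr, hrt⟩ := hle hx'
    have hex := lTensor_exact A (f := f.restrictScalars k) (g := g.restrictScalars k) hfg hg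
    obtain ⟨s, hs⟩ := (hex (t - r)).1 (by
      rw [_root_.map_sub, sub_eq_zero]
      exact hrt.symm)
    refine ⟨(relations B N).mkQ s, ?_⟩
    change (relations B N').mkQ ((f.restrictScalars k).lTensor A s) = _
    rw [hs, _root_.map_sub, sub_eq_self]
    exact (Submodule.Quotient.mk_eq_zero _).2 hr
  · rintro ⟨y, rfl⟩
    have : g ∘ₗ f = 0 := LinearMap.ext hfg.apply_apply_eq_zero
    rw [← LinearMap.comp_apply, ← RelTensor.map_comp, this, RelTensor.map_zero,
      LinearMap.zero_apply]

/-- Faithful flatness from preservation of injectivity and faithfulness. -/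
theorem faithfullyFlatRight_of_injective_of_faithful
    (hinj : ∀ (N N' : Type u) [AddCommGroup N] [Module k N] [Module B N] [IsScalarTower k B N]
      [AddCommGroup N'] [Module k N'] [Module B N'] [IsScalarTower k B N'] (f : N →ₗ[B] N'),
      Function.Injective f → Function.Injective (RelTensor.map f))
    (hfaith : ∀ (N N' : Type u) [AddCommGroup N] [Module k N] [Module B N] [IsScalarTower k B N]
      [AddCommGroup N'] [Module k N'] [Module B N'] [IsScalarTower k B N'] (f : N →ₗ[B] N'),
      RelTensor.map f = 0 → f = 0) :
    FaithfullyFlatRight B := by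
  have hex : ∀ {M₁ M₂ M₃ : Type u} [AddCommGroup M₁] [AddCommGroup M₂] [AddCommGroup M₃]
      [Module k M₁] [Module k M₂] [Module k M₃] [Module B M₁] [Module B M₂] [Module B M₃]
      [IsScalarTower k B M₁] [IsScalarTower k B M₂] [IsScalarTower k B M₃]
      (f : M₁ →ₗ[B] M₂) (g : M₂ →ₗ[B] M₃),
      Function.Exact f g → Function.Exact (RelTensor.map f) (RelTensor.map g) := by
    intro M₁ M₂ M₃ _ _ _ _ _ _ _ _ _ _ _ _ f g hfg
    -- Factor `g` through its image: right exactness handles the surjection `p`, the hypothesis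
    -- `hinj` the inclusion `i`.
    let p := g.rangeRestrict
    let i := g.range.subtype
    have hp : Function.Exact f p := fun x => by
      rw [← hfg x]
      exact Subtype.ext_iff
    have hg : RelTensor.map g = RelTensor.map i ∘ₗ RelTensor.map p := by
      rw [← RelTensor.map_comp]
      rfl
    intro x
    rw [← RelTensor.map_exact_of_surjective hp g.surjective_rangeRestrict x, hg,
      LinearMap.comp_apply]
    exact map_eq_zero_iff _ (hinj _ _ i g.range.injective_subtype)
  intro M₁ M₂ M₃ _ _ _ _ _ _ _ _ _ _ _ _ f g
  refine ⟨hex f g, fun h => ?_⟩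
  have hgf : g ∘ₗ f = 0 := hfaith _ _ _ (by
    rw [RelTensor.map_comp]
    exact LinearMap.ext h.apply_apply_eq_zero)
  intro x
  refine ⟨fun hx => ?_, ?_⟩
  -- The composite `ker g → M₂ ⧸ range f` measures the failure of exactness. It vanishes after
  -- tensoring, hence vanishes by faithfulness.
  · let i := (LinearMap.ker g).subtype
    let q := (LinearMap.range f).mkQ
    have hi : Function.Exact i g := fun y => by simp [i]
    have hqi : q ∘ₗ i = 0 := hfaith _ _ _ (by
      refine LinearMap.ext fun y => ?_
      have hy : RelTensor.map g (RelTensor.map i y) = 0 := (hex _ _ hi _).2 ⟨y, rfl⟩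
      obtain ⟨z, hz⟩ := (h _).1 hy
      rw [RelTensor.map_comp, LinearMap.comp_apply, ← hz, ← LinearMap.comp_apply,
        ← RelTensor.map_comp]
      have : q ∘ₗ f = 0 := LinearMap.range_mkQ_comp f
      rw [this, RelTensor.map_zero, LinearMap.zero_apply, LinearMap.zero_apply])
    exact (Submodule.Quotient.mk_eq_zero _).1 (LinearMap.congr_fun hqi ⟨x, hx⟩)
  · rintro ⟨y, rfl⟩
    exact LinearMap.congr_fun hgf y

end Extension

/-! ### Cofree Hopf modules -/

section Cofree

variable {k H A : Type u} [CommRing k] [Ring H] [Bialgebra k H] [Ring A] [Algebra k A]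

variable {P : Type u} [AddCommGroup P] [Module k P]

variable (k H P) in
/-- The map `H ⊗ P → H ⊗ (H ⊗ P)`, `h ⊗ p ↦ ∑ h₁ ⊗ (h₂ ⊗ p)`. -/
def comulTensor : H ⊗[k] P →ₗ[k] H ⊗[k] (H ⊗[k] P) :=
  (TensorProduct.assoc k H H P).toLinearMap ∘ₗ
    (Coalgebra.comul (R := k) (A := H)).rTensor P

theorem comulTensor_tmul (h : H) (p : P) :
    comulTensor k H P (h ⊗ₜ[k] p) =
      TensorProduct.assoc k H H P (Coalgebra.comul (R := k) h ⊗ₜ[k] p) := rfl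

/-- Both axioms are those of the coalgebra `H` with `p` carried along in the last slot; `F` performs
that insertion. -/
theorem comulTensor_isLeftComodule : IsLeftComodule (comulTensor k H P) := by
  constructor
  · refine TensorProduct.ext' fun h p => ?_
    have hc := Coalgebra.coassoc_apply (R := k) h
    let F : H ⊗[k] (H ⊗[k] H) →ₗ[k] H ⊗[k] (H ⊗[k] (H ⊗[k] P)) :=
      LinearMap.lTensor H ((TensorProduct.assoc k H H P).toLinearMap ∘ₗ
        (TensorProduct.mk k (H ⊗[k] H) P).flip p)
    have hF := congrArg F hc
    refine Eq.trans ?_ (hF.trans ?_)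
    · change TensorProduct.assoc k H H (H ⊗[k] P)
        ((Coalgebra.comul (R := k) (A := H)).rTensor (H ⊗[k] P)
          (TensorProduct.assoc k H H P (Coalgebra.comul (R := k) h ⊗ₜ[k] p))) = _
      induction Coalgebra.comul (R := k) h with
      | zero => simp
      | add x y hx hy => simp only [add_tmul, map_add, hx, hy]
      | tmul h₁ h₂ =>
        simp only [TensorProduct.assoc_tmul, LinearMap.rTensor_tmul]
        induction Coalgebra.comul (R := k) h₁ with
        | zero => simp
        | add x y hx hy => simp only [add_tmul, map_add, hx, hy]
        | tmul g₁ g₂ => simp [F]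
    · change _ = (comulTensor k H P).lTensor H
          (TensorProduct.assoc k H H P (Coalgebra.comul (R := k) h ⊗ₜ[k] p))
      induction Coalgebra.comul (R := k) h with
      | zero => simp
      | add x y hx hy => simp only [add_tmul, map_add, hx, hy]
      | tmul h₁ h₂ => rfl
  · refine TensorProduct.ext' fun h p => ?_
    have hc := Coalgebra.rTensor_counit_comul (R := k) h
    let F : k ⊗[k] H →ₗ[k] H ⊗[k] P :=
      (TensorProduct.mk k H P).flip p ∘ₗ (TensorProduct.lid k H).toLinearMap
    have hF := congrArg F hc
    refine Eq.trans ?_ (hF.trans ?_)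
    · change TensorProduct.lid k (H ⊗[k] P)
        ((Coalgebra.counit (R := k) (A := H)).rTensor (H ⊗[k] P)
          (TensorProduct.assoc k H H P (Coalgebra.comul (R := k) h ⊗ₜ[k] p))) = _
      induction Coalgebra.comul (R := k) h with
      | zero => simp
      | add x y hx hy => simp only [add_tmul, map_add, hx, hy]
      | tmul h₁ h₂ => simp [F, TensorProduct.smul_tmul']
    · simp [F]

variable (k H P) in
/-- The map `H ⊗ P → P`, `h ⊗ p ↦ ε(h) p`. -/
def counitTensor : H ⊗[k] P →ₗ[k] P :=
  (TensorProduct.lid k P).toLinearMap ∘ₗ (Coalgebra.counit (R := k) (A := H)).rTensor P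

@[simp] theorem counitTensor_tmul (h : H) (p : P) :
    counitTensor k H P (h ⊗ₜ[k] p) = Coalgebra.counit (R := k) h • p := rfl

/-- This is the counit axiom on the right factor of `Δ`. It lets a map into a cofree Hopf module be
recovered from its composite with the counit. -/
theorem lTensor_counitTensor_comulTensor :
    (counitTensor k H P).lTensor H ∘ₗ comulTensor k H P = LinearMap.id := by
  refine TensorProduct.ext' fun h p => ?_
  have hc := Coalgebra.lTensor_counit_comul (R := k) h
  have hF := congrArg ((TensorProduct.mk k H P).flip p ∘ₗ
    (TensorProduct.rid k H).toLinearMap) hc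
  refine Eq.trans ?_ (hF.trans (by simp))
  rw [LinearMap.comp_apply, comulTensor_tmul]
  induction Coalgebra.comul (R := k) h with
  | zero => simp
  | add x y hx hy => simp only [add_tmul, map_add, hx, hy]
  | tmul h₁ h₂ => simp

variable [Module A P] [IsScalarTower k A P]

theorem act_one (x : H ⊗[k] P) : act P (1 : H ⊗[k] A) x = x := by
  rw [Algebra.TensorProduct.one_def]
  induction x with
  | zero => simp
  | tmul h p => simp
  | add x y hx hy => rw [map_add, hx, hy]

theorem act_mul (s t : H ⊗[k] A) (x : H ⊗[k] P) : act P (s * t) x = act P s (act P t x) := by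
  induction s with
  | zero => simp
  | add x y hx hy => simp only [add_mul, map_add, LinearMap.add_apply, hx, hy]
  | tmul h a =>
    induction t with
    | zero => simp
    | add x y hx hy => simp only [mul_add, map_add, LinearMap.add_apply, hx, hy]
    | tmul h' a' =>
      induction x with
      | zero => simp
      | add x y hx hy => simp only [map_add, hx, hy]
      | tmul g p => simp [mul_assoc, mul_smul]

/-- Multiplicativity of `ε`. With the counit axiom for `ν` it makes the cofree counit `A`-linear. -/
theorem counitTensor_act (t : H ⊗[k] A) (x : H ⊗[k] P) :
    counitTensor k H P (act P t x) = counitTensor k H A t • counitTensor k H P x := by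
  induction t with
  | zero => simp
  | add s t hs ht => simp only [map_add, LinearMap.add_apply, hs, ht, add_smul]
  | tmul h a =>
    induction x with
    | zero => simp
    | add x y hx hy => simp only [map_add, hx, hy, smul_add]
    | tmul g p =>
      simp only [act_tmul, counitTensor_tmul, Bialgebra.counit_mul, smul_assoc, mul_smul]
      rw [← algebraMap_smul A (Coalgebra.counit (R := k) g) (a • p),
        ← algebraMap_smul A (Coalgebra.counit (R := k) g) p, smul_smul, smul_smul,
        Algebra.commutes]

/-- The componentwise action of `H ⊗ (H ⊗ A)` on `H ⊗ (H ⊗ P)`. -/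
def actTwice (P : Type u) [AddCommGroup P] [Module k P] [Module A P] [IsScalarTower k A P] :
    H ⊗[k] (H ⊗[k] A) →ₗ[k] H ⊗[k] (H ⊗[k] P) →ₗ[k] H ⊗[k] (H ⊗[k] P) :=
  TensorProduct.map₂ (LinearMap.mul k H) (act P)

theorem actTwice_tmul (h h' : H) (t : H ⊗[k] A) (x : H ⊗[k] P) :
    actTwice P (h ⊗ₜ[k] t) (h' ⊗ₜ[k] x) = (h * h') ⊗ₜ[k] act P t x := rfl

theorem actTwice_lTensor (f : A →ₗ[k] H ⊗[k] A) (t : H ⊗[k] A) (x : H ⊗[k] (H ⊗[k] P)) :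
    actTwice P (f.lTensor H t) x =
      TensorProduct.map₂ (LinearMap.mul k H) ((act P).comp f) t x := by
  have : (actTwice P).comp (f.lTensor H) =
      TensorProduct.map₂ (LinearMap.mul k H) ((act P).comp f) :=
    TensorProduct.ext' fun _ _ => TensorProduct.ext' fun _ _ => rfl
  exact LinearMap.congr_fun (LinearMap.congr_fun this t) x

/-- Multiplicativity of `Δ`. With coassociativity of `ν` it gives the Hopf compatibility of the
cofree module. -/
theorem comulTensor_act (t : H ⊗[k] A) (x : H ⊗[k] P) :
    comulTensor k H P (act P t x) = actTwice P (comulTensor k H A t) (comulTensor k H P x) := by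
  induction t with
  | zero => simp
  | add s t hs ht => simp only [map_add, LinearMap.add_apply, hs, ht]
  | tmul h a =>
    induction x with
    | zero => simp
    | add x y hx hy => simp only [map_add, hx, hy]
    | tmul g p =>
      rw [act_tmul, comulTensor_tmul, comulTensor_tmul, comulTensor_tmul, Bialgebra.comul_mul]
      induction Coalgebra.comul (R := k) h with
      | zero => simp
      | add x y hx hy => simp only [add_mul, add_tmul, map_add, LinearMap.add_apply, hx, hy]
      | tmul h₁ h₂ =>
        induction Coalgebra.comul (R := k) g with
        | zero => simp
        | add x y hx hy => simp only [mul_add, add_tmul, map_add, hx, hy]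
        | tmul g₁ g₂ => simp [actTwice_tmul]

variable {Q : Type u} [AddCommGroup Q] [Module k Q] [Module A Q] [IsScalarTower k A Q]

theorem act_lTensor (f : P →ₗ[A] Q) (t : H ⊗[k] A) (x : H ⊗[k] P) :
    (f.restrictScalars k).lTensor H (act P t x) =
      act Q t ((f.restrictScalars k).lTensor H x) := by
  induction t with
  | zero => simp
  | add x y hx hy => simp only [map_add, LinearMap.add_apply, hx, hy]
  | tmul h a =>
    induction x with
    | zero => simp
    | add x y hx hy => simp only [map_add, hx, hy]
    | tmul g p => simp

variable (ν : A →ₐ[k] H ⊗[k] A)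

/-- The underlying space `H ⊗ P` of the cofree Hopf module on a left `A`-module `P`; here `A` acts
through `ν`. -/
def Cofree (_ν : A →ₐ[k] H ⊗[k] A) (P : Type u) [AddCommGroup P] [Module k P] : Type u :=
  H ⊗[k] P

section

variable (P : Type u) [AddCommGroup P] [Module k P]

instance : AddCommGroup (Cofree ν P) := inferInstanceAs (AddCommGroup (H ⊗[k] P))

instance : Module k (Cofree ν P) := inferInstanceAs (Module k (H ⊗[k] P))

variable [Module A P] [IsScalarTower k A P]

instance : Module A (Cofree ν P) where
  smul a x := act P (ν a) x
  one_smul x := (congrArg (fun t => act P t x) (map_one ν)).trans (act_one x)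
  mul_smul a b x := (congrArg (fun t => act P t x) (map_mul ν a b)).trans (act_mul _ _ x)
  smul_zero a := map_zero (act P (ν a))
  smul_add a := map_add (act P (ν a))
  add_smul a b x := LinearMap.congr_fun (map_add ((act P).comp ν.toLinearMap) a b) x
  zero_smul x := LinearMap.congr_fun (map_zero ((act P).comp ν.toLinearMap)) x

instance : IsScalarTower k A (Cofree ν P) where
  smul_assoc c a x := LinearMap.congr_fun (map_smul ((act P).comp ν.toLinearMap) c a) x

end

variable {ν}

variable (ν) in
/-- The `A`-linear map `H ⊗ f`. -/
def Cofree.map (f : P →ₗ[A] Q) : Cofree ν P →ₗ[A] Cofree ν Q where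
  toFun := (f.restrictScalars k).lTensor H
  map_add' := map_add ((f.restrictScalars k).lTensor H)
  map_smul' a := act_lTensor f (ν a)

theorem act_cofree (t : H ⊗[k] A) (x : H ⊗[k] Cofree ν P) :
    act (Cofree ν P) t x = actTwice P (ν.toLinearMap.lTensor H t) x :=
  (actTwice_lTensor ν.toLinearMap t x).symm

variable (P ν) in
/-- The coaction of the cofree Hopf module. -/
def Cofree.comul : Cofree ν P →ₗ[k] H ⊗[k] Cofree ν P := comulTensor k H P

variable (P) in
/-- The cofree Hopf module on an `A`-module. -/
def cofreeHopf (hν : IsLeftComodule ν.toLinearMap) : HopfMod ν where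
  carrier := Cofree ν P
  coaction := Cofree.comul P ν
  isLeftComodule := comulTensor_isLeftComodule
  coaction_smul a x := by
    rw [act_cofree]
    exact (comulTensor_act (ν a) x).trans (congrArg (fun t => actTwice P t (comulTensor k H P x))
      (LinearMap.congr_fun hν.coassoc a))

variable (P) in
/-- The counit `H ⊗ P → P`, `h ⊗ p ↦ ε(h) p`. -/
def Cofree.counit (hν : IsLeftComodule ν.toLinearMap) : Cofree ν P →ₗ[A] P where
  toFun := counitTensor k H P
  map_add' := map_add (counitTensor k H P)
  map_smul' a x := (counitTensor_act (ν a) x).trans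
    (congrArg (fun b : A => b • counitTensor k H P x) (LinearMap.congr_fun hν.counit a))

/-- The coaction of a Hopf module as an `A`-linear map `M → H ⊗ M`. -/
def HopfMod.coactionLinear (M : HopfMod ν) : M.carrier →ₗ[A] Cofree ν M.carrier where
  toFun := M.coaction
  map_add' := map_add M.coaction
  map_smul' := M.coaction_smul

theorem HopfMod.coactionLinear_injective (M : HopfMod ν) :
    Function.Injective M.coactionLinear :=
  Function.LeftInverse.injective (g := counitTensor k H M.carrier) fun m =>
    LinearMap.congr_fun M.isLeftComodule.counit m

/-- A morphism into a cofree Hopf module is determined by its composition with the counit. -/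
theorem HopfMod.hom_cofree_apply (hν : IsLeftComodule ν.toLinearMap) {M : HopfMod ν}
    (f : M ⟶ cofreeHopf P hν) (m : M.carrier) :
    f.toLinearMap m =
      Cofree.map ν (Cofree.counit P hν ∘ₗ f.toLinearMap) (M.coactionLinear m) := by
  refine (LinearMap.congr_fun lTensor_counitTensor_comulTensor (f.toLinearMap m)).symm.trans ?_
  refine (congrArg ((counitTensor k H P).lTensor H) (LinearMap.congr_fun f.colinear m)).trans ?_
  exact (LinearMap.lTensor_comp_apply H (counitTensor k H P)
    (f.toLinearMap.restrictScalars k) (M.coaction m)).symm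

theorem HopfMod.hom_cofree_ext (hν : IsLeftComodule ν.toLinearMap) {M : HopfMod ν}
    {f g : M ⟶ cofreeHopf P hν}
    (h : Cofree.counit P hν ∘ₗ f.toLinearMap = Cofree.counit P hν ∘ₗ g.toLinearMap) :
    f = g := by
  refine HopfMod.Hom.ext (LinearMap.ext fun m => ?_)
  rw [HopfMod.hom_cofree_apply, HopfMod.hom_cofree_apply, h]

end Cofree

/-! ### The Galois map `A ⊗_B P → H ⊗ P` -/

section Galois

variable {k H A : Type u} [CommRing k] [Ring H] [Bialgebra k H] [Ring A] [Algebra k A]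
variable {ν : A →ₐ[k] H ⊗[k] A} {B : Subalgebra k A}
variable (P : Type u) [AddCommGroup P] [Module k P] [Module A P] [IsScalarTower k A P]
variable {Q : Type u} [AddCommGroup Q] [Module k Q] [Module A Q] [IsScalarTower k A Q]

/-- The `B`-linear map `p ↦ 1 ⊗ p`. -/
def Cofree.unit (hB : B ≤ coinvariants ν) : P →ₗ[B] Cofree ν P where
  toFun p := ((1 : H) ⊗ₜ[k] p : H ⊗[k] P)
  map_add' p q := TensorProduct.tmul_add (1 : H) p q
  map_smul' b p := by
    change _ = act P (ν (b : A)) ((1 : H) ⊗ₜ[k] p)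
    have hb : ν (b : A) = 1 ⊗ₜ[k] (b : A) := hB b.2
    rw [hb, act_tmul, one_mul]
    rfl

/-- The map `A ⊗_B P → H ⊗ P`, `a ⊗ p ↦ ∑ a₁ ⊗ a₂ p`. -/
def galoisMap (hB : B ≤ coinvariants ν) : RelTensor B P →ₗ[A] Cofree ν P :=
  RelTensor.extend (Cofree.unit P hB)

variable {P}

theorem galoisMap_mk (hB : B ≤ coinvariants ν) (p : P) (a : A) :
    galoisMap P hB (RelTensor.mk B p a) = act P (ν a) ((1 : H) ⊗ₜ[k] p) := rfl

theorem galoisMap_mk_one (hB : B ≤ coinvariants ν) (p : P) :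
    galoisMap P hB (RelTensor.mk B p 1) = Cofree.unit P hB p :=
  one_smul A (Cofree.unit P hB p)

theorem galoisMap_naturality (hB : B ≤ coinvariants ν) (f : P →ₗ[A] Q) :
    Cofree.map ν f ∘ₗ galoisMap P hB =
      galoisMap Q hB ∘ₗ RelTensor.map (f.restrictScalars B) := by
  refine RelTensor.hom_ext fun p => ?_
  rw [LinearMap.comp_apply, LinearMap.comp_apply, RelTensor.map_mk, galoisMap_mk_one,
    galoisMap_mk_one]
  rfl

theorem canonicalMap_eq_galoisMap (hB : B ≤ coinvariants ν) (x : RelTensor B A) :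
    canonicalMap B hB x = galoisMap A hB x := by
  induction x using RelTensor.induction_on with
  | zero => exact (map_zero _).trans (map_zero (galoisMap A hB)).symm
  | add x y hx hy =>
    exact (map_add _ x y).trans ((congrArg₂ (· + ·) hx hy).trans
      (map_add (galoisMap A hB) x y).symm)
  | mk a' a =>
    refine Eq.trans ?_ (galoisMap_mk hB a' a).symm
    change ν a * (1 ⊗ₜ[k] a') = _
    induction ν a with
    | zero => simp
    | add x y hx hy => rw [add_mul, map_add, LinearMap.add_apply, hx, hy]
    | tmul h c => simp

theorem RelTensor.mk_smul {N : Type u} [AddCommGroup N] [Module k N] [Module B N] (c : k) (n : N)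
    (a : A) : RelTensor.mk B (c • n) a = c • RelTensor.mk B n a := by
  simp [RelTensor.mk]

variable (B) in
/-- The map `A ⊗_B A → A ⊗_B P`, `a ⊗ a' ↦ a ⊗ a' p`. -/
def RelTensor.mulRight (p : P) : RelTensor B A →ₗ[A] RelTensor B P :=
  RelTensor.map ((LinearMap.toSpanSingleton A P p).restrictScalars B)

theorem RelTensor.mulRight_mk (p : P) (a a' : A) :
    RelTensor.mulRight B p (RelTensor.mk B a' a) = RelTensor.mk B (a' • p) a := rfl

theorem RelTensor.mulRight_smul (p : P) (a : A) (x : RelTensor B A) :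
    RelTensor.mulRight B (a • p) x = RelTensor.mulRight B p (RelTensor.mulRight B a x) := by
  have : RelTensor.mulRight B (a • p) = RelTensor.mulRight B p ∘ₗ RelTensor.mulRight B a := by
    refine RelTensor.hom_ext fun c => ?_
    rw [LinearMap.comp_apply, mulRight_mk, mulRight_mk, mulRight_mk, smul_smul, smul_eq_mul]
  exact LinearMap.congr_fun this x

/-- Naturality along `A → P`, `a ↦ a p`, reduces questions about `P` to the canonical map. -/
theorem galoisMap_mulRight (hB : B ≤ coinvariants ν) (p : P) (x : RelTensor B A) :
    galoisMap P hB (RelTensor.mulRight B p x) =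
      Cofree.map ν (LinearMap.toSpanSingleton A P p) (galoisMap A hB x) :=
  (LinearMap.congr_fun (galoisMap_naturality hB (LinearMap.toSpanSingleton A P p)) x).symm

variable (B P) in
/-- The map `A ⊗_B A → A ⊗_B P`, `a ⊗ a' ↦ a ⊗ a' p`, as a function of `p`. -/
def RelTensor.mulRightLinear : P →ₗ[k] RelTensor B A →ₗ[k] RelTensor B P where
  toFun p := (RelTensor.mulRight B p).restrictScalars k
  map_add' p q := by
    have : RelTensor.mulRight B (p + q) = RelTensor.mulRight B p + RelTensor.mulRight B q := by
      refine RelTensor.hom_ext fun c => ?_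
      rw [LinearMap.add_apply, mulRight_mk, mulRight_mk, mulRight_mk, smul_add, mk_add]
    rw [this]
    rfl
  map_smul' c p := by
    refine LinearMap.ext fun x => ?_
    induction x using RelTensor.induction_on with
    | zero => simp
    | add x y hx hy => rw [_root_.map_add, _root_.map_add, hx, hy]
    | mk a' a =>
      change RelTensor.mk B (a' • c • p) a = c • RelTensor.mk B (a' • p) a
      rw [smul_comm, mk_smul]

/-- If the canonical map is bijective, so is `A ⊗_B P → H ⊗ P` for every `A`-module `P`. -/
theorem galoisMap_bijective (hB : B ≤ coinvariants ν)
    (hcan : Function.Bijective (canonicalMap B hB)) : Function.Bijective (galoisMap P hB) := by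
  let e : RelTensor B A ≃ₗ[k] H ⊗[k] A := LinearEquiv.ofBijective _ hcan
  have he : ∀ t, galoisMap A hB (e.symm t) = t := fun t =>
    (canonicalMap_eq_galoisMap hB _).symm.trans (e.apply_symm_apply t)
  -- The candidate inverse sends `h ⊗ p` to the preimage of `h ⊗ 1` under the canonical map,
  -- multiplied on the right by `p`.
  let γ : H ⊗[k] P →ₗ[k] RelTensor B P := TensorProduct.lift
    ((RelTensor.mulRightLinear B P).flip ∘ₗ e.symm.toLinearMap ∘ₗ
      (TensorProduct.mk k H A).flip 1)
  have hγ : ∀ h p, γ (h ⊗ₜ[k] p) = RelTensor.mulRight B p (e.symm (h ⊗ₜ[k] 1)) :=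
    fun _ _ => rfl
  have hright : ∀ x : H ⊗[k] P, galoisMap P hB (γ x) = x := by
    intro x
    induction x with
    | zero => exact (congrArg _ (map_zero γ)).trans (map_zero (galoisMap P hB))
    | add x y hx hy =>
      exact (congrArg _ (map_add γ x y)).trans ((map_add (galoisMap P hB) _ _).trans
        (congrArg₂ (· + ·) hx hy))
    | tmul h p =>
      rw [hγ, galoisMap_mulRight, he]
      exact congrArg (h ⊗ₜ[k] ·) (one_smul A p)
  -- The inverse of the canonical map is right `A`-linear because the canonical map is.
  have hmul : ∀ (h : H) (a : A),
      e.symm (h ⊗ₜ[k] a) = RelTensor.mulRight B a (e.symm (h ⊗ₜ[k] 1)) := by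
    intro h a
    refine e.injective ((e.apply_symm_apply _).trans (Eq.symm ?_))
    refine (canonicalMap_eq_galoisMap hB _).trans ?_
    rw [galoisMap_mulRight, he]
    exact congrArg (h ⊗ₜ[k] ·) (one_mul a)
  have hact : ∀ (t : H ⊗[k] A) (p : P),
      γ (act P t ((1 : H) ⊗ₜ[k] p)) = RelTensor.mulRight B p (e.symm t) := by
    intro t p
    induction t with
    | zero => simp
    | add x y hx hy => simp only [map_add, LinearMap.add_apply, hx, hy]
    | tmul h a => rw [act_tmul, mul_one, hγ, RelTensor.mulRight_smul, ← hmul]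
  have hleft : ∀ x : RelTensor B P, γ (galoisMap P hB x) = x := by
    intro x
    induction x using RelTensor.induction_on with
    | zero => exact (congrArg γ (map_zero (galoisMap P hB))).trans (map_zero γ)
    | add x y hx hy =>
      exact (congrArg γ (map_add (galoisMap P hB) x y)).trans ((map_add γ _ _).trans
        (congrArg₂ (· + ·) hx hy))
    | mk p a =>
      refine (hact (ν a) p).trans ?_
      -- The canonical map sends `a ⊗ 1` to `ν a`, so its inverse returns `a ⊗ 1`.
      have h1 : ν a = e (RelTensor.mk B 1 a) := by
        refine Eq.trans ?_ (rfl : ν a * (1 ⊗ₜ[k] 1) = _)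
        rw [← Algebra.TensorProduct.one_def, mul_one]
      rw [h1, e.symm_apply_apply, RelTensor.mulRight_mk, one_smul]
  exact ⟨Function.LeftInverse.injective (g := γ) hleft,
    Function.RightInverse.surjective (g := γ) hright⟩

end Galois

/-! ### Morphisms of Hopf modules -/

section Morphisms

variable {k H A : Type u} [CommRing k] [Ring H] [Bialgebra k H] [Ring A] [Algebra k A]
variable {ν : A →ₐ[k] H ⊗[k] A}

/-- A morphism of Hopf modules from colinearity of `A`-linear maps. -/
def HopfMod.homMk {M N : HopfMod ν} (f : M.carrier →ₗ[A] N.carrier)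
    (h : N.coactionLinear ∘ₗ f = Cofree.map ν f ∘ₗ M.coactionLinear) : M ⟶ N :=
  HopfMod.Hom.mk f (LinearMap.ext fun m => LinearMap.congr_fun h m)

theorem HopfMod.hom_inv_apply {M N : HopfMod ν} (i : M ≅ N) (m : M.carrier) :
    i.inv.toLinearMap (i.hom.toLinearMap m) = m :=
  congrArg (fun f : M ⟶ M => f.toLinearMap m) i.hom_inv_id

theorem HopfMod.inv_hom_apply {M N : HopfMod ν} (i : M ≅ N) (n : N.carrier) :
    i.hom.toLinearMap (i.inv.toLinearMap n) = n :=
  congrArg (fun f : N ⟶ N => f.toLinearMap n) i.inv_hom_id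

/-- The inverse is automatically colinear: `H ⊗ f` is undone by `H ⊗ f⁻¹`, and every element of `N`
is some `f m`. -/
theorem HopfMod.isIso_of_bijective {M N : HopfMod ν} (f : M ⟶ N)
    (hf : Function.Bijective f.toLinearMap) : IsIso f := by
  let e : M.carrier ≃ₗ[A] N.carrier := LinearEquiv.ofBijective _ hf
  have hcol : N.coactionLinear ∘ₗ f.toLinearMap =
      Cofree.map ν f.toLinearMap ∘ₗ M.coactionLinear :=
    LinearMap.ext fun m => LinearMap.congr_fun f.colinear m
  have hsymm : e.symm.toLinearMap ∘ₗ f.toLinearMap = LinearMap.id :=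
    LinearMap.ext e.symm_apply_apply
  have hid : ∀ x, Cofree.map ν e.symm.toLinearMap (Cofree.map ν f.toLinearMap x) = x := by
    intro x
    refine (LinearMap.lTensor_comp_apply H (e.symm.toLinearMap.restrictScalars k)
      (f.toLinearMap.restrictScalars k) x).symm.trans ?_
    have : e.symm.toLinearMap.restrictScalars k ∘ₗ f.toLinearMap.restrictScalars k =
        LinearMap.id := LinearMap.ext e.symm_apply_apply
    rw [this]
    exact LinearMap.lTensor_id_apply H _ x
  let g : N ⟶ M := HopfMod.homMk e.symm.toLinearMap (by
    refine LinearMap.ext fun n => ?_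
    obtain ⟨m, rfl⟩ := hf.2 n
    have h1 := LinearMap.congr_fun hsymm m
    have h2 := LinearMap.congr_fun hcol m
    simp only [LinearMap.comp_apply] at h1 h2 ⊢
    rw [h1, h2, hid]
    rfl)
  exact ⟨g, HopfMod.Hom.ext hsymm, HopfMod.Hom.ext (LinearMap.ext e.apply_symm_apply)⟩

end Morphisms

/-! ### Descent -/

section Descent

variable {k H A : Type u} [CommRing k] [Ring H] [Bialgebra k H] [Ring A] [Algebra k A]
variable {ν : A →ₐ[k] H ⊗[k] A} {B : Subalgebra k A}
variable (hν : IsLeftComodule ν.toLinearMap) (hB : B ≤ coinvariants ν)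

include hν in
-- Both sides agree on `1 ⊗ n`. This is the link between coactions and descent data.
theorem functorA_coactionLinear (N : ModuleCat.{u} B) :
    ((functorA hν hB).obj N).coactionLinear =
      galoisMap (RelTensor B N) hB ∘ₗ RelTensor.map (RelTensor.unit B N) := by
  refine RelTensor.hom_ext fun n => ?_
  refine Eq.trans ?_ (galoisMap_mk_one hB (RelTensor.mk B n 1)).symm
  refine (relCoaction_mk hB n 1).trans ?_
  rw [map_one, Algebra.TensorProduct.one_def]
  rfl

/-- The `B`-linear map `m ↦ ζ(m) - 1 ⊗ m`, whose kernel is the module of coinvariants. -/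
def HopfMod.coinvDiff (M : HopfMod ν) : M.carrier →ₗ[B] Cofree ν M.carrier :=
  M.coactionLinear.restrictScalars B - Cofree.unit M.carrier hB

theorem HopfMod.coinvDiff_eq_zero_iff (M : HopfMod ν) (m : M.carrier) :
    M.coinvDiff hB m = 0 ↔ M.coactionLinear m = Cofree.unit M.carrier hB m :=
  sub_eq_zero

theorem functorA_coinv_unit (N : ModuleCat.{u} B) (n : N) :
    ((functorA hν hB).obj N).coactionLinear (RelTensor.mk B n 1) =
      Cofree.unit (RelTensor B N) hB (RelTensor.mk B n 1) := by
  rw [functorA_coactionLinear]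
  exact galoisMap_mk_one hB (RelTensor.mk B n 1)

variable {hB} in
/-- The coinvariants of `A ⊗_B N` are the `1 ⊗ n`. -/
theorem functorA_mem_range_unit (hff : FaithfullyFlatRight B)
    (hcan : Function.Bijective (canonicalMap B hB)) (N : ModuleCat.{u} B) (x : RelTensor B N)
    (hx : ((functorA hν hB).obj N).coactionLinear x = Cofree.unit (RelTensor B N) hB x) :
    x ∈ LinearMap.range (RelTensor.unit B N) := by
  refine (hff.exact_unit_descentDiff x).1 (sub_eq_zero.2 ?_)
  -- Under the injective Galois map the descent condition on `x` becomes its coinvariance.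
  refine (galoisMap_bijective hB hcan).1 ?_
  rw [functorA_coactionLinear] at hx
  exact hx.trans (galoisMap_mk_one hB x).symm

theorem HopfMod.hom_coinv {M N : HopfMod ν} (f : M ⟶ N) {m : M.carrier}
    (hm : M.coactionLinear m = Cofree.unit M.carrier hB m) :
    N.coactionLinear (f.toLinearMap m) = Cofree.unit N.carrier hB (f.toLinearMap m) :=
  (LinearMap.congr_fun f.colinear m).trans (congrArg (Cofree.map ν f.toLinearMap) hm)

variable {hB} in
-- A Hopf map sends the coinvariant `1 ⊗ m` to a coinvariant, that is, to `1 ⊗ f m` for a unique `f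
-- m`.
theorem functorA_full (hff : FaithfullyFlatRight B)
    (hcan : Function.Bijective (canonicalMap B hB)) : (functorA hν hB).Full := by
  refine ⟨fun {M N} g => ?_⟩
  let g' : RelTensor B M →ₗ[A] RelTensor B N := g.toLinearMap
  have hg : ∀ m : M, g' (RelTensor.mk B m 1) ∈ LinearMap.range (RelTensor.unit B N) := fun m =>
    functorA_mem_range_unit hν hff hcan N _
      (HopfMod.hom_coinv hB g (functorA_coinv_unit hν hB M m))
  let e := LinearEquiv.ofInjective (RelTensor.unit B N) hff.unit_injective
  let f : M →ₗ[B] N := e.symm.toLinearMap ∘ₗ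
    (g'.restrictScalars B ∘ₗ RelTensor.unit B M).codRestrict _ hg
  refine ⟨ModuleCat.ofHom f, HopfMod.Hom.ext (RelTensor.hom_ext fun m => ?_)⟩
  exact congrArg Subtype.val (e.apply_symm_apply ⟨_, hg m⟩)

theorem functorA_faithful (hff : FaithfullyFlatRight B) : (functorA hν hB).Faithful :=
  ⟨fun {_ _ _ _} h => ModuleCat.hom_ext (hff.map_injective (congrArg HopfMod.Hom.toLinearMap h))⟩

variable {hB} in
include hν in
-- Here `N` plays the coinvariants of `M`. After `A ⊗_B (-)`, the Galois maps identify their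
-- defining sequence with `H ⊗ M ⇉ H ⊗ H ⊗ M`, the arrows being `H ⊗ ζ` and `Δ ⊗ M`; the image of
-- `ζ` lies in its equalizer by coassociativity.
theorem extend_coinv_bijective (hff : FaithfullyFlatRight B)
    (hcan : Function.Bijective (canonicalMap B hB)) (M : HopfMod ν) (N : ModuleCat.{u} B)
    (j : N →ₗ[B] M.carrier) (hj : Function.Injective j)
    (hex : Function.Exact j (M.coinvDiff hB)) :
    Function.Bijective (RelTensor.extend j) := by
  have hmap : galoisMap M.carrier hB ∘ₗ RelTensor.map j =
      M.coactionLinear ∘ₗ RelTensor.extend j := by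
    refine RelTensor.hom_ext fun n => ?_
    rw [LinearMap.comp_apply, RelTensor.map_mk, galoisMap_mk_one, LinearMap.comp_apply,
      RelTensor.extend_mk, one_smul]
    exact ((M.coinvDiff_eq_zero_iff hB _).1 (hex.apply_apply_eq_zero n)).symm
  have hmap' := LinearMap.congr_fun hmap
  simp only [LinearMap.comp_apply] at hmap'
  constructor
  · intro x y hxy
    refine (hff.injective_iff j).1 hj ((galoisMap_bijective hB hcan).1 ?_)
    rw [hmap', hmap', hxy]
  · intro m
    obtain ⟨y, hy⟩ := (galoisMap_bijective (P := M.carrier) hB hcan).2 (M.coactionLinear m)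
    let Δ : Cofree ν M.carrier →ₗ[A] Cofree ν (Cofree ν M.carrier) :=
      (cofreeHopf M.carrier hν).coactionLinear
    have hcomul : galoisMap (Cofree ν M.carrier) hB ∘ₗ RelTensor.map (Cofree.unit M.carrier hB) =
        Δ ∘ₗ galoisMap M.carrier hB := by
      refine RelTensor.hom_ext fun m => ?_
      rw [LinearMap.comp_apply, RelTensor.map_mk, galoisMap_mk_one, LinearMap.comp_apply,
        galoisMap_mk_one]
      change (1 : H) ⊗ₜ[k] ((1 : H) ⊗ₜ[k] m) = comulTensor k H M.carrier ((1 : H) ⊗ₜ[k] m)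
      rw [comulTensor_tmul, Bialgebra.comul_one, Algebra.TensorProduct.one_def,
        TensorProduct.assoc_tmul]
    -- Coassociativity at `m`, read through the Galois map of `H ⊗ M`; flatness then lifts `y` to `A
    -- ⊗_B N`.
    have hy0 : RelTensor.map (M.coinvDiff hB) y = 0 := by
      refine (galoisMap_bijective (P := Cofree ν M.carrier) hB hcan).1 ?_
      rw [map_zero, HopfMod.coinvDiff, RelTensor.map_sub, LinearMap.sub_apply, map_sub,
        sub_eq_zero]
      have h1 := LinearMap.congr_fun (galoisMap_naturality hB M.coactionLinear) y
      have h2 := LinearMap.congr_fun hcomul y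
      rw [LinearMap.comp_apply, LinearMap.comp_apply, hy] at h1 h2
      rw [← h1, h2]
      exact (LinearMap.congr_fun M.isLeftComodule.coassoc m).symm
    obtain ⟨z, hz⟩ := ((hff _ _ _ _ _).1 hex y).1 hy0
    refine ⟨z, M.coactionLinear_injective ?_⟩
    rw [← hmap', hz, hy]

variable {hB} in
theorem functorA_essSurj (hff : FaithfullyFlatRight B)
    (hcan : Function.Bijective (canonicalMap B hB)) : (functorA hν hB).EssSurj := by
  have key : ∀ (M : HopfMod ν) (N : ModuleCat.{u} B) (j : N →ₗ[B] M.carrier),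
      Function.Injective j → Function.Exact j (M.coinvDiff hB) →
      Nonempty ((functorA hν hB).obj N ≅ M) := by
    intro M N j hj hex
    let f : (functorA hν hB).obj N ⟶ M := HopfMod.homMk (RelTensor.extend j) (by
      refine RelTensor.hom_ext fun n => ?_
      have hn := functorA_coinv_unit hν hB N n
      have hM := (M.coinvDiff_eq_zero_iff hB _).1 (hex.apply_apply_eq_zero n)
      have h1 : RelTensor.extend j (RelTensor.mk B n 1) = j n := one_smul A (j n)
      refine (congrArg M.coactionLinear h1).trans (hM.trans ?_)
      refine Eq.trans ?_ (congrArg (Cofree.map ν (RelTensor.extend j)) hn).symm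
      exact (congrArg (Cofree.unit M.carrier hB) h1).symm)
    have : IsIso f :=
      HopfMod.isIso_of_bijective f (extend_coinv_bijective hν hff hcan M N j hj hex)
    exact ⟨asIso f⟩
  refine ⟨fun M => ⟨ModuleCat.of B (LinearMap.ker (M.coinvDiff hB)), ?_⟩⟩
  exact key M _ (LinearMap.ker (M.coinvDiff hB)).subtype (Submodule.injective_subtype _)
    fun m => by simp

/-- Faithfully flat descent for Hopf modules. -/
theorem functorA_isEquivalence (hff : FaithfullyFlatRight B)
    (hcan : Function.Bijective (canonicalMap B hB)) : (functorA hν hB).IsEquivalence where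
  faithful := functorA_faithful hν hB hff
  full := functorA_full hν hff hcan
  essSurj := functorA_essSurj hν hff hcan

end Descent

/-! ### Kernels of Hopf modules over a flat bialgebra -/

section Kernel

variable {k H A : Type u} [CommRing k] [Ring H] [Bialgebra k H] [Ring A] [Algebra k A]
variable {ν : A →ₐ[k] H ⊗[k] A}
variable {P : Type u} [AddCommGroup P] [Module k P] {Q : Type u} [AddCommGroup Q] [Module k Q]

theorem comulTensor_naturality (f : P →ₗ[k] Q) (x : H ⊗[k] P) :
    (f.lTensor H).lTensor H (comulTensor k H P x) = comulTensor k H Q (f.lTensor H x) := by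
  induction x with
  | zero => simp
  | add x y hx hy => simp only [map_add, hx, hy]
  | tmul h p =>
    rw [LinearMap.lTensor_tmul, comulTensor_tmul, comulTensor_tmul]
    induction Coalgebra.comul (R := k) h with
    | zero => simp
    | add x y hx hy => simp only [add_tmul, map_add, hx, hy]
    | tmul h₁ h₂ => simp

theorem counitTensor_naturality (f : P →ₗ[k] Q) (x : H ⊗[k] P) :
    f (counitTensor k H P x) = counitTensor k H Q (f.lTensor H x) := by
  induction x with
  | zero => simp
  | add x y hx hy => simp only [map_add, hx, hy]
  | tmul h p => simp

/-- Over a flat bialgebra, the kernel of a morphism of Hopf modules is a Hopf module. -/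
theorem HopfMod.exists_kernel [Module.Flat k H] {M L : HopfMod ν} (f : M ⟶ L) :
    ∃ (K : HopfMod ν) (i : K ⟶ M), Function.Injective i.toLinearMap ∧
      Function.Exact i.toLinearMap f.toLinearMap := by
  let K := LinearMap.ker f.toLinearMap
  let i : K →ₗ[k] M.carrier := K.subtype.restrictScalars k
  have hi : Function.Injective i := K.injective_subtype
  have hex : Function.Exact i (f.toLinearMap.restrictScalars k) := fun m => by simp [i, K]
  have hHi : Function.Injective (i.lTensor H) :=
    Module.Flat.lTensor_preserves_injective_linearMap i hi
  have hHHi : Function.Injective ((i.lTensor H).lTensor H) :=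
    Module.Flat.lTensor_preserves_injective_linearMap _ hHi
  have hHex := Module.Flat.lTensor_exact H hex
  -- By flatness `H ⊗ K` is the kernel of `H ⊗ f`, so colinearity of `f` restricts the coaction to
  -- `K`. The axioms are then checked inside `H ⊗ M` and `H ⊗ H ⊗ M`.
  have hmem : ∀ x : K, M.coaction (i x) ∈ LinearMap.range (i.lTensor H) := by
    intro x
    refine (hHex _).1 ?_
    have h := LinearMap.congr_fun f.colinear (i x)
    refine h.symm.trans ((congrArg L.coaction x.2).trans (map_zero L.coaction))
  let e := LinearEquiv.ofInjective (i.lTensor H) hHi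
  let ζ : K →ₗ[k] H ⊗[k] K := e.symm.toLinearMap ∘ₗ (M.coaction ∘ₗ i).codRestrict _ hmem
  have hζ : ∀ x, i.lTensor H (ζ x) = M.coaction (i x) := fun x =>
    congrArg Subtype.val (e.apply_symm_apply ⟨_, hmem x⟩)
  have hζ' : i.lTensor H ∘ₗ ζ = M.coaction ∘ₗ i := LinearMap.ext hζ
  have hcom : IsLeftComodule ζ := by
    constructor
    · refine LinearMap.ext fun x => hHHi ?_
      refine (comulTensor_naturality i (ζ x)).trans ?_
      rw [hζ, LinearMap.comp_apply, ← LinearMap.lTensor_comp_apply, hζ',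
        LinearMap.lTensor_comp_apply, hζ]
      exact LinearMap.congr_fun M.isLeftComodule.coassoc (i x)
    · refine LinearMap.ext fun x => hi ?_
      refine (counitTensor_naturality i (ζ x)).trans ?_
      rw [hζ]
      exact LinearMap.congr_fun M.isLeftComodule.counit (i x)
  refine ⟨{ carrier := K, coaction := ζ, isLeftComodule := hcom, coaction_smul := ?_ },
    ⟨K.subtype, hζ'.symm⟩, hi, hex⟩
  intro a x
  apply hHi
  rw [hζ]
  refine (M.coaction_smul a (i x)).trans ?_
  rw [← hζ]
  exact (act_lTensor K.subtype (ν a) (ζ x)).symm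

end Kernel

/-! ### Consequences of `A ⊗_B (-)` being an equivalence -/

section Equivalence

variable {k H A : Type u} [CommRing k] [Ring H] [Bialgebra k H] [Ring A] [Algebra k A]
variable {ν : A →ₐ[k] H ⊗[k] A} {B : Subalgebra k A}
variable (hν : IsLeftComodule ν.toLinearMap) (hB : B ≤ coinvariants ν)

variable {N : Type u} [AddCommGroup N] [Module k N] [Module B N] [IsScalarTower k B N]
variable {N' : Type u} [AddCommGroup N'] [Module k N'] [Module B N'] [IsScalarTower k B N']

theorem RelTensor.map_apply_map_symm (i : N ≃ₗ[B] N') (x : RelTensor B N) :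
    RelTensor.map i.symm.toLinearMap (RelTensor.map i.toLinearMap x) = x := by
  rw [← LinearMap.comp_apply, ← RelTensor.map_comp, LinearEquiv.symm_comp, RelTensor.map_id,
    LinearMap.id_apply]

theorem functorS_faithful [(functorA hν hB).Faithful] : (functorS B).Faithful := by
  refine ⟨fun {M N f g} h => (functorA hν hB).map_injective (HopfMod.Hom.ext ?_)⟩
  exact LinearMap.ext fun x => LinearMap.congr_fun (congrArg ModuleCat.Hom.hom h) x

theorem Cofree.counit_unit (P : Type u) [AddCommGroup P] [Module k P] [Module A P]
    [IsScalarTower k A P] (p : P) :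
    Cofree.counit P hν (Cofree.unit P hB p) = p := by
  change counitTensor k H P ((1 : H) ⊗ₜ[k] p) = p
  rw [counitTensor_tmul, Bialgebra.counit_one, one_smul]

/-- The adjunction between `A ⊗_B (-)` and the cofree Hopf module on an `A`-module `P`. -/
def homCofree (N : ModuleCat.{u} B) {P : Type u} [AddCommGroup P] [Module k P] [Module A P]
    [IsScalarTower k A P] (j : N →ₗ[B] P) : (functorA hν hB).obj N ⟶ cofreeHopf P hν :=
  HopfMod.homMk (M := (functorA hν hB).obj N) (N := cofreeHopf P hν)
    (galoisMap P hB ∘ₗ RelTensor.map j) (by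
      refine RelTensor.hom_ext fun n => ?_
      have h1 : (galoisMap P hB ∘ₗ RelTensor.map j) (RelTensor.mk B n 1) =
          Cofree.unit P hB (j n) := galoisMap_mk_one hB (j n)
      have h2 := functorA_coinv_unit hν hB N n
      refine (congrArg (comulTensor k H P) h1).trans (Eq.symm ?_)
      refine (congrArg (Cofree.map ν (galoisMap P hB ∘ₗ RelTensor.map j)) h2).trans ?_
      refine (congrArg ((1 : H) ⊗ₜ[k] ·) h1).trans ?_
      refine Eq.trans ?_ (comulTensor_tmul (1 : H) (j n)).symm
      rw [Bialgebra.comul_one, Algebra.TensorProduct.one_def, TensorProduct.assoc_tmul]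
      rfl)

theorem homCofree_mk_one (N : ModuleCat.{u} B) {P : Type u} [AddCommGroup P] [Module k P]
    [Module A P] [IsScalarTower k A P] (j : N →ₗ[B] P) (n : N) :
    Cofree.counit P hν ((homCofree hν hB N j).toLinearMap (RelTensor.mk B n 1)) = j n :=
  (congrArg (Cofree.counit P hν) (galoisMap_mk_one hB (j n))).trans
    (Cofree.counit_unit hν hB P (j n))

theorem hom_cofree_ext_mk_one (N : ModuleCat.{u} B) {P : Type u} [AddCommGroup P] [Module k P]
    [Module A P] [IsScalarTower k A P] {f g : (functorA hν hB).obj N ⟶ cofreeHopf P hν}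
    (h : ∀ n : N, Cofree.counit P hν (f.toLinearMap (RelTensor.mk B n 1)) =
      Cofree.counit P hν (g.toLinearMap (RelTensor.mk B n 1))) : f = g :=
  HopfMod.hom_cofree_ext hν (RelTensor.hom_ext h)

/-- A Yoneda argument: maps from `𝒜(N)` to `H ⊗ A` are `B`-maps `N → A`, hence maps from `𝒜(N)` to
`𝒜(A)`, and every Hopf module is some `𝒜(N)`. The object `X` is `A` with its `k`-structure
restricted from `B`. -/
theorem isIso_homCofree [(functorA hν hB).IsEquivalence] {X : ModuleCat.{u} B} (i : X ≃ₗ[B] A) :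
    IsIso (homCofree hν hB X i.toLinearMap) := by
  let F := functorA hν hB
  let C := cofreeHopf A hν
  let β : F.obj X ⟶ C := homCofree hν hB X i.toLinearMap
  let N := F.objPreimage C
  let φ : F.obj N ≅ C := F.objObjPreimageIso C
  let φ' : RelTensor B N →ₗ[A] Cofree ν A := φ.hom.toLinearMap
  let u : N →ₗ[B] A := (Cofree.counit A hν ∘ₗ φ').restrictScalars B ∘ₗ RelTensor.unit B N
  let u' : N ⟶ X := ModuleCat.ofHom (i.symm.toLinearMap ∘ₗ u)
  -- The isomorphism from `𝒜(N)` factors through `β`, which gives `β` a section `s`.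
  have hu : F.map u' ≫ β = φ.hom := by
    refine hom_cofree_ext_mk_one hν hB N fun n => ?_
    exact (homCofree_mk_one hν hB X i.toLinearMap (i.symm (u n))).trans (i.apply_symm_apply _)
  let s : C ⟶ F.obj X := φ.inv ≫ F.map u'
  have hs : s ≫ β = 𝟙 C := by
    rw [Category.assoc, hu, φ.inv_hom_id]
  let t : X ⟶ X := F.preimage (β ≫ s)
  have ht : F.map t = β ≫ s := F.map_preimage _
  have htβ : F.map t ≫ β = β := by
    rw [ht, Category.assoc, hs, Category.comp_id]
  -- Under the adjunction `htβ` says that `i` composed with `t` is `i`, so `s` is also a left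
  -- inverse.
  have ht1 : t = 𝟙 X := by
    refine ModuleCat.hom_ext (LinearMap.ext fun x => i.injective ?_)
    have h1 := homCofree_mk_one hν hB X i.toLinearMap (t.hom x)
    have h2 := homCofree_mk_one hν hB X i.toLinearMap x
    have h3 := congrArg (fun f : F.obj X ⟶ C =>
      Cofree.counit A hν (f.toLinearMap (RelTensor.mk B x 1))) htβ
    exact h1.symm.trans (h3.trans h2)
  refine ⟨s, ?_, hs⟩
  rw [← ht, ht1, F.map_id]

theorem canonicalMap_bijective_of_isIso {X : ModuleCat.{u} B} (i : X ≃ₗ[B] A)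
    [IsIso (homCofree hν hB X i.toLinearMap)] : Function.Bijective (canonicalMap B hB) := by
  let β := asIso (homCofree hν hB X i.toLinearMap)
  have h1 : ∀ x, RelTensor.map i.toLinearMap (RelTensor.map i.symm.toLinearMap x) = x :=
    RelTensor.map_apply_map_symm i.symm
  have h2 : ∀ x, RelTensor.map i.symm.toLinearMap (RelTensor.map i.toLinearMap x) = x :=
    RelTensor.map_apply_map_symm i
  have hβ : ∀ x, canonicalMap B hB x =
      β.hom.toLinearMap (RelTensor.map i.symm.toLinearMap x) := fun x =>
    (canonicalMap_eq_galoisMap hB x).trans (congrArg (galoisMap A hB) (h1 x)).symm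
  have hbij : Function.Bijective β.hom.toLinearMap :=
    ⟨Function.LeftInverse.injective (HopfMod.hom_inv_apply β),
      Function.RightInverse.surjective (HopfMod.inv_hom_apply β)⟩
  have hi : Function.Bijective (RelTensor.map i.symm.toLinearMap) :=
    ⟨Function.LeftInverse.injective h1, Function.RightInverse.surjective h2⟩
  exact (funext hβ : ⇑(canonicalMap B hB) = _) ▸ hbij.comp hi

theorem canonicalMap_bijective [(functorA hν hB).IsEquivalence] :
    Function.Bijective (canonicalMap B hB) :=
  have := isIso_homCofree hν hB (X := ModuleCat.of B A) (LinearEquiv.refl B A)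
  canonicalMap_bijective_of_isIso hν hB (X := ModuleCat.of B A) (LinearEquiv.refl B A)

/-- The kernel of `𝒜(f)` is a Hopf module by flatness, hence comes from some `g : N ⟶ X` with `f`
after `g` zero. As `f` is injective, `g = 0` and the kernel vanishes. -/
theorem map_hom_injective_of_isEquivalence [Module.Flat k H] [(functorA hν hB).IsEquivalence]
    {X Y : ModuleCat.{u} B} (f : X ⟶ Y) (hf : Function.Injective f.hom) :
    Function.Injective (RelTensor.map f.hom) := by
  let F := functorA hν hB
  obtain ⟨K, i, hi, hex⟩ := HopfMod.exists_kernel (F.map f)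
  let N := F.objPreimage K
  let φ : F.obj N ≅ K := F.objObjPreimageIso K
  let g : N ⟶ X := F.preimage (φ.hom ≫ i)
  have hg : F.map g = φ.hom ≫ i := F.map_preimage _
  have hgf : g ≫ f = ModuleCat.ofHom 0 := by
    refine F.map_injective (HopfMod.Hom.ext ?_)
    refine Eq.trans ?_ (RelTensor.map_zero (B := B) (N := N) (N' := Y)).symm
    rw [F.map_comp, hg]
    exact LinearMap.ext fun x => hex.apply_apply_eq_zero _
  have hg0 : g.hom = 0 := LinearMap.ext fun n => hf
    ((LinearMap.congr_fun (congrArg ModuleCat.Hom.hom hgf) n).trans (map_zero f.hom).symm)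
  have hi0 : ∀ x, i.toLinearMap x = 0 := by
    intro x
    rw [← HopfMod.inv_hom_apply φ x]
    have h1 : (F.map g).toLinearMap = 0 := by
      refine Eq.trans ?_ (RelTensor.map_zero (B := B) (N := N) (N' := X))
      exact congrArg RelTensor.map hg0
    rw [hg] at h1
    exact LinearMap.congr_fun h1 (φ.inv.toLinearMap x)
  rw [injective_iff_map_eq_zero]
  intro x hx
  obtain ⟨y, rfl⟩ := (hex x).1 hx
  exact hi0 y

include hν hB in
-- Transport along `i` and `i'` passes from objects of `ModuleCat` to modules carrying their own
-- compatible `k`-structure.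
theorem map_injective_of_isEquivalence [Module.Flat k H] [(functorA hν hB).IsEquivalence]
    {X Y : ModuleCat.{u} B} (i : N ≃ₗ[B] X) (i' : N' ≃ₗ[B] Y) {f : N →ₗ[B] N'}
    (hf : Function.Injective f) : Function.Injective (RelTensor.map f) := by
  let f' : X ⟶ Y := ModuleCat.ofHom (i'.toLinearMap ∘ₗ f ∘ₗ i.symm.toLinearMap)
  have hf' : Function.Injective f'.hom :=
    i'.injective.comp (hf.comp i.symm.injective)
  have h : ∀ x, RelTensor.map f x = RelTensor.map i'.symm.toLinearMap
      (RelTensor.map f'.hom (RelTensor.map i.toLinearMap x)) := by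
    intro x
    have hc : f = i'.symm.toLinearMap ∘ₗ f'.hom ∘ₗ i.toLinearMap := by
      ext n
      simp [f']
    conv_lhs => rw [hc]
    rw [RelTensor.map_comp, RelTensor.map_comp]
    rfl
  intro x y hxy
  rw [h, h] at hxy
  have h1 := (Function.LeftInverse.injective (RelTensor.map_apply_map_symm i'.symm)) hxy
  exact (Function.LeftInverse.injective (RelTensor.map_apply_map_symm i))
    (map_hom_injective_of_isEquivalence hν hB f' hf' h1)

include hν hB in
theorem eq_zero_of_map_eq_zero [(functorA hν hB).Faithful]
    {X Y : ModuleCat.{u} B} (i : N ≃ₗ[B] X) (i' : N' ≃ₗ[B] Y) {f : N →ₗ[B] N'}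
    (hf : RelTensor.map f = 0) : f = 0 := by
  let f' : X ⟶ Y := ModuleCat.ofHom (i'.toLinearMap ∘ₗ f ∘ₗ i.symm.toLinearMap)
  have h0 : f' = ModuleCat.ofHom 0 := by
    refine (functorA hν hB).map_injective (HopfMod.Hom.ext ?_)
    refine Eq.trans ?_ (RelTensor.map_zero (B := B) (N := X) (N' := Y)).symm
    have h : RelTensor.map f'.hom = RelTensor.map i'.toLinearMap ∘ₗ RelTensor.map f ∘ₗ
        RelTensor.map i.symm.toLinearMap := by
      rw [← RelTensor.map_comp, ← RelTensor.map_comp]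
      rfl
    refine h.trans ?_
    rw [hf, LinearMap.zero_comp, LinearMap.comp_zero]
  refine LinearMap.ext fun n => i'.injective ?_
  have h1 := LinearMap.congr_fun (congrArg ModuleCat.Hom.hom h0) (i n)
  rw [LinearMap.zero_apply, map_zero]
  simpa [f'] using h1

include hν hB in
theorem faithfullyFlatRight_of_isEquivalence [Module.Flat k H]
    [(functorA hν hB).IsEquivalence] : FaithfullyFlatRight B :=
  faithfullyFlatRight_of_injective_of_faithful
    (fun N N' _ _ _ _ _ _ _ _ _ hf => map_injective_of_isEquivalence hν hB
      (X := ModuleCat.of B N) (Y := ModuleCat.of B N') (LinearEquiv.refl B N)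
      (LinearEquiv.refl B N') hf)
    (fun N N' _ _ _ _ _ _ _ _ _ hf => eq_zero_of_map_eq_zero hν hB
      (X := ModuleCat.of B N) (Y := ModuleCat.of B N') (LinearEquiv.refl B N)
      (LinearEquiv.refl B N') hf)

end Equivalence

end HopfGalois

end

theorem theoremt {k H A : Type u} [CommRing k] [Ring H] [Bialgebra k H] [Ring A] [Algebra k A]
    (ν : A →ₐ[k] H ⊗[k] A) (hν : IsLeftComodule ν.toLinearMap)
    (B : Subalgebra k A) (hB : B ≤ coinvariants ν) :
    ((FaithfullyFlatRight B ∧ Function.Bijective (canonicalMap B hB)) →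
        (functorA hν hB).IsEquivalence) ∧
    ((functorA hν hB).IsEquivalence → (functorS B).Faithful) ∧
    (Module.Flat k H →
      ((FaithfullyFlatRight B ∧ Function.Bijective (canonicalMap B hB)) ↔
        (functorA hν hB).IsEquivalence)) :=
  ⟨fun h => functorA_isEquivalence hν hB h.1 h.2, fun _ => functorS_faithful hν hB, fun _ =>
    ⟨fun h => functorA_isEquivalence hν hB h.1 h.2, fun _ =>
      ⟨faithfullyFlatRight_of_isEquivalence hν hB, canonicalMap_bijective hν hB⟩⟩⟩
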